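/- All Banach spaces are complex, "subspace" means closed linear subspace, and $\widehat\otimes$ is the completed projective tensor product. A \emph{projective tensor quasinorm} is a map $\alpha$ with values in $[0,\infty]$, defined on the elements of all $X\widehat\otimes Y$ ($X,Y$ Banach spaces), such that $\alpha(u)=0$ implies $u=0$; $\alpha(au)=|a|\,\alpha(u)$ for scalars $a$ (with $0\cdot\infty=0$); $\alpha(u_1+u_2)\le C(\alpha(u_1)+\alpha(u_2))$ with a constant $C>0$ independent of $X,Y$; $\alpha(x\otimes y)=\|x\|\,\|y\|$; and $\alpha((A\otimes B)u)\le\|A\|\,\alpha(u)\,\|B\|$ for bounded operators $A,B$. Let $X\widehat\otimes_\alpha Y$ be the set of $u\in X\widehat\otimes Y$ with $\alpha(u)<\infty$ for which there are $u_n\in X\otimes Y$ with $\alpha(u-u_n)\to0$; $\alpha$ is \emph{complete} if in each $X\widehat\otimes_\alpha Y$ every $\alpha$-Cauchy sequence $\alpha$-converges to an element of it. Let $N_\alpha(X,Y)$ be the image of $X^*\widehat\otimes_\alpha Y$ under the canonical map $u\mapsto\tilde u$ into the bounded operators $L(X,Y)$, and $N_\alpha(X)=N_\alpha(X,X)$.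 A Banach space $X$ has the \emph{$\alpha$-extension property} if for every subspace $X_0\subset X$ with inclusion $i:X_0\to X$ and every $z_0\in X_0^*\widehat\otimes_\alpha X_0$ there is $z\in X^*\widehat\otimes_\alpha X_0$ with $z\circ i=z_0$ and $\operatorname{trace}(i\circ z)=\operatorname{trace}z_0$. For $0<p<\infty$, $0<q\le\infty$ let $l_{p,q}$ be the Lorentz space of sequences $a\in c_0$ with $\big(\sum_n (a_n^*)^q n^{q/p-1}\big)^{1/q}<\infty$ (for $q=\infty$: $\sup_n a_n^* n^{1/p}<\infty$), where $a_n^*=\inf_{|J|<n}\sup_{j\notin J}|a_j|$. An operator $T\in L(X,X)$ has \emph{spectral type $l_{p,q}$} if its nonzero eigenvalues have finite algebraic multiplicity and no accumulation point other than possibly $0$, and the sequence of them, repeated according to algebraic multiplicity (and completed by zeros if finite), lies in $l_{p,q}$. A space of operators on $X$ has spectral type $l_{p,q}$ if all its members do. \textbf{Theorem.} Let $\alpha$ be a complete projective tensor quasinorm, let $0<p<\infty$ and $0<q\le\infty$, and let $X$ be a Banach space with the $\alpha$-extension property. If $N_\alpha(X)$ has spectral type $l_{p,q}$, then $N_\alpha(X_0)$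 has spectral type $l_{p,q}$ for every subspace $X_0$ of $X$. -/

import Mathlib

open scoped TensorProduct ENNReal Topology

universe u

noncomputable section

/-! ### The completed projective tensor product -/

/-- The algebraic tensor product `X ⊗ Y`, as a type of its own, so that it can carry the
projective norm. -/
def AlgTensor (X Y : Type*) [NormedAddCommGroup X] [NormedSpace ℂ X]
    [NormedAddCommGroup Y] [NormedSpace ℂ Y] := X ⊗[ℂ] Y

namespace AlgTensor

variable {X Y Z : Type*} [NormedAddCommGroup X] [NormedSpace ℂ X]
  [NormedAddCommGroup Y] [NormedSpace ℂ Y] [NormedAddCommGroup Z] [NormedSpace ℂ Z]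

instance : AddCommGroup (AlgTensor X Y) := inferInstanceAs (AddCommGroup (X ⊗[ℂ] Y))
instance : Module ℂ (AlgTensor X Y) := inferInstanceAs (Module ℂ (X ⊗[ℂ] Y))

/-- The elementary tensor `x ⊗ y`. -/
def tmul (x : X) (y : Y) : AlgTensor X Y := x ⊗ₜ[ℂ] y

/-- The linear map on the algebraic tensor product given by a bilinear map. -/
def liftAlg (B : X →L[ℂ] Y →L[ℂ] Z) : AlgTensor X Y →ₗ[ℂ] Z :=
  TensorProduct.lift
    (LinearMap.mk₂ ℂ (fun x y => B x y) (by simp) (by simp) (by simp) (by simp) :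
      X →ₗ[ℂ] Y →ₗ[ℂ] Z)

theorem liftAlg_tmul (B : X →L[ℂ] Y →L[ℂ] Z) (x : X) (y : Y) :
    liftAlg B (tmul x y) = B x y :=
  TensorProduct.lift.tmul x y

/-- The costs `∑ ‖x_k‖ ‖y_k‖` of all finite representations `w = ∑ x_k ⊗ y_k`. -/
def costs (w : AlgTensor X Y) : Set ℝ :=
  {r | ∃ (n : ℕ) (x : Fin n → X) (y : Fin n → Y),
    w = ∑ k, tmul (x k) (y k) ∧ r = ∑ k, ‖x k‖ * ‖y k‖}

/-- The projective norm `‖w‖ = inf {∑ ‖x_k‖ ‖y_k‖ : w = ∑ x_k ⊗ y_k}`. -/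
def projNorm (w : AlgTensor X Y) : ℝ := sInf (costs w)

theorem costs_nonneg (w : AlgTensor X Y) : ∀ r ∈ costs w, 0 ≤ r := by
  rintro r ⟨n, x, y, -, rfl⟩
  positivity

theorem costs_bddBelow (w : AlgTensor X Y) : BddBelow (costs w) := ⟨0, costs_nonneg w⟩

theorem tmul_mem_costs (x : X) (y : Y) : ‖x‖ * ‖y‖ ∈ costs (tmul x y) :=
  ⟨1, fun _ => x, fun _ => y, by simp, by simp⟩

theorem zero_mem_costs : (0 : ℝ) ∈ costs (0 : AlgTensor X Y) :=
  ⟨0, fun _ => 0, fun _ => 0, by simp, by simp⟩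

theorem add_mem_costs {v w : AlgTensor X Y} {r s : ℝ} (hr : r ∈ costs v) (hs : s ∈ costs w) :
    r + s ∈ costs (v + w) := by
  obtain ⟨n, x, y, rfl, rfl⟩ := hr
  obtain ⟨m, x', y', rfl, rfl⟩ := hs
  exact ⟨n + m, Fin.append x x', Fin.append y y', by simp [Fin.sum_univ_add],
    by simp [Fin.sum_univ_add]⟩

theorem smul_mem_costs (a : ℂ) {w : AlgTensor X Y} {r : ℝ} (hr : r ∈ costs w) :
    ‖a‖ * r ∈ costs (a • w) := by
  obtain ⟨n, x, y, rfl, rfl⟩ := hr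
  refine ⟨n, fun k => a • x k, y, ?_, ?_⟩
  · rw [Finset.smul_sum]
    exact Finset.sum_congr rfl fun k _ => TensorProduct.smul_tmul' a (x k) (y k)
  · simp [Finset.mul_sum, norm_smul, mul_assoc]

theorem costs_nonempty (w : AlgTensor X Y) : (costs w).Nonempty := by
  induction w using TensorProduct.induction_on with
  | zero => exact ⟨0, zero_mem_costs⟩
  | tmul x y => exact ⟨_, tmul_mem_costs x y⟩
  | add v w hv hw =>
    obtain ⟨r, hr⟩ := hv
    obtain ⟨s, hs⟩ := hw
    exact ⟨r + s, add_mem_costs hr hs⟩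

theorem projNorm_nonneg (w : AlgTensor X Y) : 0 ≤ projNorm w :=
  Real.sInf_nonneg (costs_nonneg w)

theorem projNorm_le {w : AlgTensor X Y} {r : ℝ} (h : r ∈ costs w) : projNorm w ≤ r :=
  csInf_le (costs_bddBelow w) h

theorem projNorm_tmul_le (x : X) (y : Y) : projNorm (tmul x y) ≤ ‖x‖ * ‖y‖ :=
  projNorm_le (tmul_mem_costs x y)

theorem projNorm_zero : projNorm (0 : AlgTensor X Y) = 0 :=
  le_antisymm (projNorm_le zero_mem_costs) (projNorm_nonneg _)

theorem projNorm_add_le (v w : AlgTensor X Y) : projNorm (v + w) ≤ projNorm v + projNorm w := by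
  refine le_of_forall_pos_le_add fun ε hε => ?_
  obtain ⟨r, hr, hr'⟩ := Real.lt_sInf_add_pos (costs_nonempty v) (half_pos hε)
  obtain ⟨s, hs, hs'⟩ := Real.lt_sInf_add_pos (costs_nonempty w) (half_pos hε)
  have := projNorm_le (add_mem_costs hr hs)
  unfold projNorm at *
  linarith

theorem projNorm_smul_le (a : ℂ) (w : AlgTensor X Y) : projNorm (a • w) ≤ ‖a‖ * projNorm w := by
  rcases eq_or_ne a 0 with rfl | ha
  · simp [projNorm_zero]
  have ha' : 0 < ‖a‖ := norm_pos_iff.2 ha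
  rw [← div_le_iff₀' ha']
  refine le_csInf (costs_nonempty w) fun r hr => ?_
  rw [div_le_iff₀' ha']
  exact projNorm_le (smul_mem_costs a hr)

theorem projNorm_neg_le (w : AlgTensor X Y) : projNorm (-w) ≤ projNorm w := by
  simpa using projNorm_smul_le (-1) w

theorem projNorm_neg (w : AlgTensor X Y) : projNorm (-w) = projNorm w :=
  le_antisymm (projNorm_neg_le w) (by simpa using projNorm_neg_le (-w))

instance : SeminormedAddCommGroup (AlgTensor X Y) :=
  AddGroupSeminorm.toSeminormedAddCommGroup
    { toFun := projNorm
      map_zero' := projNorm_zero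
      add_le' := projNorm_add_le
      neg' := projNorm_neg }

theorem norm_def (w : AlgTensor X Y) : ‖w‖ = projNorm w := rfl

instance : NormedSpace ℂ (AlgTensor X Y) where
  norm_smul_le := projNorm_smul_le

theorem norm_liftAlg_le (B : X →L[ℂ] Y →L[ℂ] Z) (w : AlgTensor X Y) :
    ‖liftAlg B w‖ ≤ ‖B‖ * ‖w‖ := by
  have key : ∀ r ∈ costs w, ‖liftAlg B w‖ ≤ ‖B‖ * r := by
    rintro r ⟨n, x, y, rfl, rfl⟩
    rw [map_sum, Finset.mul_sum]
    refine (norm_sum_le _ _).trans (Finset.sum_le_sum fun k _ => ?_)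
    rw [liftAlg_tmul, ← mul_assoc]
    exact B.le_opNorm₂ _ _
  rw [norm_def]
  rcases (norm_nonneg B).eq_or_lt with h | h
  · obtain ⟨r, hr⟩ := costs_nonempty w
    simpa [← h] using key r hr
  · rw [← div_le_iff₀' h]
    refine le_csInf (costs_nonempty w) fun r hr => ?_
    rw [div_le_iff₀' h]
    exact key r hr

end AlgTensor

/-- The projective tensor product: the completion of `X ⊗ Y` in the projective norm. -/
abbrev ProjTensor (X Y : Type*) [NormedAddCommGroup X] [NormedSpace ℂ X]
    [NormedAddCommGroup Y] [NormedSpace ℂ Y] := UniformSpace.Completion (AlgTensor X Y)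

namespace ProjTensor

variable {X Y Z X' Y' : Type*} [NormedAddCommGroup X] [NormedSpace ℂ X]
  [NormedAddCommGroup Y] [NormedSpace ℂ Y] [NormedAddCommGroup Z] [NormedSpace ℂ Z]
  [NormedAddCommGroup X'] [NormedSpace ℂ X'] [NormedAddCommGroup Y'] [NormedSpace ℂ Y']

/-- The canonical map `X ⊗ Y → X ⊗̂ Y`. -/
def ofAlg : AlgTensor X Y →L[ℂ] ProjTensor X Y := UniformSpace.Completion.toComplL

/-- The elementary tensor `x ⊗ y` in `X ⊗̂ Y`. -/
def tmul (x : X) (y : Y) : ProjTensor X Y := ofAlg (AlgTensor.tmul x y)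

theorem norm_tmul_le (x : X) (y : Y) : ‖tmul x y‖ ≤ ‖x‖ * ‖y‖ := by
  have h : ‖tmul x y‖ = ‖AlgTensor.tmul x y‖ := UniformSpace.Completion.norm_coe _
  rw [h]
  exact AlgTensor.projNorm_tmul_le x y

/-- The canonical bounded bilinear map `X × Y → X ⊗̂ Y`, `(x, y) ↦ x ⊗ y`. -/
def mkL (X Y : Type*) [NormedAddCommGroup X] [NormedSpace ℂ X]
    [NormedAddCommGroup Y] [NormedSpace ℂ Y] : X →L[ℂ] Y →L[ℂ] ProjTensor X Y :=
  LinearMap.mkContinuous₂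
    (LinearMap.mk₂ ℂ (fun (x : X) (y : Y) => tmul x y)
      (fun x x' y => by
        rw [tmul, tmul, tmul, ← map_add]
        exact congrArg ofAlg (TensorProduct.add_tmul x x' y))
      (fun a x y => by
        rw [tmul, tmul, ← map_smul]
        exact congrArg ofAlg (TensorProduct.smul_tmul' a x y).symm)
      (fun x y y' => by
        rw [tmul, tmul, tmul, ← map_add]
        exact congrArg ofAlg (TensorProduct.tmul_add x y y'))
      (fun a x y => by
        rw [tmul, tmul, ← map_smul]
        exact congrArg ofAlg (TensorProduct.tmul_smul a x y)))
    1 (fun x y => by simpa using norm_tmul_le x y)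

theorem mkL_apply (x : X) (y : Y) : mkL X Y x y = tmul x y := rfl

/-- The bounded linear map on `X ⊗̂ Y` determined by a bounded bilinear map on `X × Y`. -/
def lift [CompleteSpace Z] (B : X →L[ℂ] Y →L[ℂ] Z) : ProjTensor X Y →L[ℂ] Z :=
  ((AlgTensor.liftAlg B).mkContinuous ‖B‖ (AlgTensor.norm_liftAlg_le B)).extend
    (ofAlg : AlgTensor X Y →L[ℂ] ProjTensor X Y)

theorem lift_ofAlg [CompleteSpace Z] (B : X →L[ℂ] Y →L[ℂ] Z) (w : AlgTensor X Y) :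
    lift B (ofAlg w) = AlgTensor.liftAlg B w :=
  ContinuousLinearMap.extend_eq _ UniformSpace.Completion.denseRange_coe
    (UniformSpace.Completion.isUniformInducing_coe _) w

theorem lift_tmul [CompleteSpace Z] (B : X →L[ℂ] Y →L[ℂ] Z) (x : X) (y : Y) :
    lift B (tmul x y) = B x y := by
  rw [tmul, lift_ofAlg, AlgTensor.liftAlg_tmul]

/-- The operator `A ⊗ B : X ⊗̂ Y → X' ⊗̂ Y'`. -/
def map (A : X →L[ℂ] X') (B : Y →L[ℂ] Y') : ProjTensor X Y →L[ℂ] ProjTensor X' Y' :=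
  lift ((mkL X' Y').bilinearComp A B)

theorem map_tmul (A : X →L[ℂ] X') (B : Y →L[ℂ] Y') (x : X) (y : Y) :
    map A B (tmul x y) = tmul (A x) (B y) := by
  rw [map, lift_tmul]; rfl

/-- The trace functional on `X* ⊗̂ X`, determined by `trace (x' ⊗ x) = x' x`. -/
def trace (X : Type*) [NormedAddCommGroup X] [NormedSpace ℂ X] :
    ProjTensor (StrongDual ℂ X) X →L[ℂ] ℂ :=
  lift (ContinuousLinearMap.id ℂ (StrongDual ℂ X))

theorem trace_tmul (f : StrongDual ℂ X) (x : X) : trace X (tmul f x) = f x := by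
  rw [trace, lift_tmul]; rfl

/-- The canonical map `X* ⊗̂ Y → L(X, Y)`, `u ↦ ũ`, which sends `x' ⊗ y` to `x ↦ x' x • y`. -/
def toOperator (X Y : Type*) [NormedAddCommGroup X] [NormedSpace ℂ X]
    [NormedAddCommGroup Y] [NormedSpace ℂ Y] [CompleteSpace Y] :
    ProjTensor (StrongDual ℂ X) Y →L[ℂ] (X →L[ℂ] Y) :=
  lift (ContinuousLinearMap.smulRightL ℂ X Y)

theorem toOperator_tmul [CompleteSpace Y] (f : StrongDual ℂ X) (y : Y) (x : X) :
    toOperator X Y (tmul f y) x = f x • y := by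
  rw [toOperator, lift_tmul]; rfl

/-- The composition `z ∘ A ∈ X'* ⊗̂ Y` of `z ∈ X* ⊗̂ Y` with an operator `A : X' → X`;
it sends `x' ⊗ y` to `(x' ∘ A) ⊗ y`. -/
def compRight (z : ProjTensor (StrongDual ℂ X) Y) (A : X' →L[ℂ] X) :
    ProjTensor (StrongDual ℂ X') Y :=
  map ((ContinuousLinearMap.compL ℂ X' X ℂ).flip A) (ContinuousLinearMap.id ℂ Y) z

theorem compRight_tmul (f : StrongDual ℂ X) (y : Y) (A : X' →L[ℂ] X) :
    compRight (tmul f y) A = tmul (f.comp A) y := by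
  rw [compRight, map_tmul]; rfl

/-- The composition `B ∘ z ∈ X* ⊗̂ Y'` of `z ∈ X* ⊗̂ Y` with an operator `B : Y → Y'`;
it sends `x' ⊗ y` to `x' ⊗ B y`. -/
def compLeft (B : Y →L[ℂ] Y') (z : ProjTensor (StrongDual ℂ X) Y) :
    ProjTensor (StrongDual ℂ X) Y' :=
  map (ContinuousLinearMap.id ℂ (StrongDual ℂ X)) B z

theorem compLeft_tmul (f : StrongDual ℂ X) (y : Y) (B : Y →L[ℂ] Y') :
    compLeft B (tmul f y) = tmul f (B y) := by
  rw [compLeft, map_tmul]; rfl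

end ProjTensor

/-! ### Projective tensor quasinorms -/

/-- A projective tensor quasinorm: a `[0, ∞]`-valued function on the elements of all projective
tensor products of Banach spaces, which is a quasinorm on each of them, with a common constant in
the quasi-triangle inequality, is a cross-quasinorm, and has the metric mapping property.
(That `X ⊗ Y` is dense in `X ⊗̂_α Y` needs no axiom here: `X ⊗̂_α Y` is defined below
as an `α`-closure.) -/
structure ProjectiveTensorQuasinorm where
  /-- the value `α(u)` for `u ∈ X ⊗̂ Y` -/
  val : ∀ {X Y : Type u} [NormedAddCommGroup X] [NormedSpace ℂ X] [CompleteSpace X]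
    [NormedAddCommGroup Y] [NormedSpace ℂ Y] [CompleteSpace Y], ProjTensor X Y → ℝ≥0∞
  eq_zero_of_val_eq_zero : ∀ {X Y : Type u} [NormedAddCommGroup X] [NormedSpace ℂ X]
    [CompleteSpace X] [NormedAddCommGroup Y] [NormedSpace ℂ Y] [CompleteSpace Y]
    (z : ProjTensor X Y), val z = 0 → z = 0
  val_smul : ∀ {X Y : Type u} [NormedAddCommGroup X] [NormedSpace ℂ X] [CompleteSpace X]
    [NormedAddCommGroup Y] [NormedSpace ℂ Y] [CompleteSpace Y] (a : ℂ) (z : ProjTensor X Y),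
    val (a • z) = ‖a‖ₑ * val z
  val_tmul : ∀ {X Y : Type u} [NormedAddCommGroup X] [NormedSpace ℂ X] [CompleteSpace X]
    [NormedAddCommGroup Y] [NormedSpace ℂ Y] [CompleteSpace Y] (x : X) (y : Y),
    val (ProjTensor.tmul x y) = ‖x‖ₑ * ‖y‖ₑ
  exists_val_add_le : ∃ C : NNReal, 0 < C ∧
    ∀ {X Y : Type u} [NormedAddCommGroup X] [NormedSpace ℂ X] [CompleteSpace X]
      [NormedAddCommGroup Y] [NormedSpace ℂ Y] [CompleteSpace Y] (z w : ProjTensor X Y),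
      val (z + w) ≤ C * (val z + val w)
  val_map_le : ∀ {X Y E F : Type u} [NormedAddCommGroup X] [NormedSpace ℂ X] [CompleteSpace X]
    [NormedAddCommGroup Y] [NormedSpace ℂ Y] [CompleteSpace Y]
    [NormedAddCommGroup E] [NormedSpace ℂ E] [CompleteSpace E]
    [NormedAddCommGroup F] [NormedSpace ℂ F] [CompleteSpace F]
    (A : X →L[ℂ] E) (B : Y →L[ℂ] F) (z : ProjTensor X Y),
    val (ProjTensor.map A B z) ≤ ‖A‖ₑ * val z * ‖B‖ₑ

namespace ProjectiveTensorQuasinorm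

/-- The `α`-projective tensor product `X ⊗̂_α Y`: the `α`-closure of `X ⊗ Y` in the space of
all `z ∈ X ⊗̂ Y` with `α(z) < ∞`. -/
def tensor (α : ProjectiveTensorQuasinorm.{u}) (X Y : Type u)
    [NormedAddCommGroup X] [NormedSpace ℂ X] [CompleteSpace X]
    [NormedAddCommGroup Y] [NormedSpace ℂ Y] [CompleteSpace Y] :
    Submodule ℂ (ProjTensor X Y) where
  carrier := {z | α.val z < ∞ ∧ ∃ w : ℕ → AlgTensor X Y,
    Filter.Tendsto (fun n => α.val (z - ProjTensor.ofAlg (w n))) Filter.atTop (𝓝 0)}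
  zero_mem' := by
    have h0 : α.val (0 : ProjTensor X Y) = 0 := by
      simpa using α.val_smul (0 : ℂ) (0 : ProjTensor X Y)
    exact ⟨by simp [h0], fun _ => 0, by simp [h0]⟩
  add_mem' := by
    rintro z z' ⟨hz, w, hw⟩ ⟨hz', w', hw'⟩
    obtain ⟨C, -, hC⟩ := α.exists_val_add_le
    refine ⟨(hC z z').trans_lt
      (ENNReal.mul_lt_top ENNReal.coe_lt_top (ENNReal.add_lt_top.2 ⟨hz, hz'⟩)),
      fun n => w n + w' n, ?_⟩
    have hlim := ENNReal.Tendsto.const_mul (a := (C : ℝ≥0∞)) (hw.add hw')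
      (Or.inr ENNReal.coe_ne_top)
    simp only [add_zero, mul_zero] at hlim
    refine tendsto_of_tendsto_of_tendsto_of_le_of_le tendsto_const_nhds hlim
      (fun _ => zero_le) fun n => ?_
    have : z + z' - ProjTensor.ofAlg (w n + w' n)
        = (z - ProjTensor.ofAlg (w n)) + (z' - ProjTensor.ofAlg (w' n)) := by
      rw [map_add]; abel
    simp only [this]
    exact hC _ _
  smul_mem' := by
    rintro a z ⟨hz, w, hw⟩
    refine ⟨by rw [α.val_smul]; exact ENNReal.mul_lt_top enorm_lt_top hz, fun n => a • w n, ?_⟩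
    have hlim := ENNReal.Tendsto.const_mul (a := ‖a‖ₑ) hw (Or.inr enorm_ne_top)
    simp only [mul_zero] at hlim
    refine hlim.congr fun n => ?_
    rw [map_smul, ← smul_sub, α.val_smul]

/-- `α` is complete: every `X ⊗̂_α Y` is complete, i.e. each `α`-Cauchy sequence in it
`α`-converges to an element of it. -/
def IsComplete (α : ProjectiveTensorQuasinorm.{u}) : Prop :=
  ∀ (X Y : Type u) [NormedAddCommGroup X] [NormedSpace ℂ X] [CompleteSpace X]
    [NormedAddCommGroup Y] [NormedSpace ℂ Y] [CompleteSpace Y] (z : ℕ → ProjTensor X Y),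
    (∀ n, z n ∈ α.tensor X Y) →
    (∀ ε > 0, ∃ N, ∀ m ≥ N, ∀ n ≥ N, α.val (z m - z n) < ε) →
    ∃ z' ∈ α.tensor X Y, Filter.Tendsto (fun n => α.val (z n - z')) Filter.atTop (𝓝 0)

/-- The space `N_α(X, Y)` of `α`-nuclear operators: the image of `X* ⊗̂_α Y` in `L(X, Y)`. -/
def nuclear (α : ProjectiveTensorQuasinorm.{u}) (X Y : Type u)
    [NormedAddCommGroup X] [NormedSpace ℂ X] [CompleteSpace X]
    [NormedAddCommGroup Y] [NormedSpace ℂ Y] [CompleteSpace Y] : Submodule ℂ (X →L[ℂ] Y) :=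
  (α.tensor (StrongDual ℂ X) Y).map (ProjTensor.toOperator X Y).toLinearMap

/-- `X` has the `α`-extension property: for every closed subspace `X₀ ⊆ X` with inclusion `i`,
each `z₀ ∈ X₀* ⊗̂_α X₀` has an extension `z ∈ X* ⊗̂_α X₀`, so that `z ∘ i = z₀` and
`trace (i ∘ z) = trace z₀`. -/
def HasExtensionProperty (α : ProjectiveTensorQuasinorm.{u}) (X : Type u)
    [NormedAddCommGroup X] [NormedSpace ℂ X] [CompleteSpace X] : Prop :=
  ∀ (X₀ : Submodule ℂ X) [CompleteSpace X₀],
    ∀ z₀ ∈ α.tensor (StrongDual ℂ X₀) X₀, ∃ z ∈ α.tensor (StrongDual ℂ X) X₀,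
      ProjTensor.compRight z X₀.subtypeL = z₀ ∧
      ProjTensor.trace X (ProjTensor.compLeft X₀.subtypeL z) = ProjTensor.trace X₀ z₀

end ProjectiveTensorQuasinorm

/-! ### Lorentz sequence spaces and spectral type -/

/-- The nonincreasing rearrangement, indexed from `0`: `decRearr a n` is
`a*_{n+1} = inf_{|J| < n+1} sup_{j ∉ J} |a_j|`. -/
def decRearr (a : ℕ → ℂ) (n : ℕ) : ℝ≥0∞ :=
  ⨅ (J : Finset ℕ) (_ : J.card < n + 1), ⨆ (j : ℕ) (_ : j ∉ J), ‖a j‖ₑ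

/-- The Lorentz quasinorm, `(∑_{n ≥ 1} (a*_n)^q n^{q/p-1})^{1/q}` for `q < ∞` and
`sup_{n ≥ 1} a*_n n^{1/p}` for `q = ∞`. -/
def lorentzNorm (p : ℝ) (q : ℝ≥0∞) (a : ℕ → ℂ) : ℝ≥0∞ :=
  if q = ∞ then ⨆ n : ℕ, decRearr a n * ((n : ℝ≥0∞) + 1) ^ (1 / p)
  else (∑' n : ℕ, decRearr a n ^ q.toReal * ((n : ℝ≥0∞) + 1) ^ (q.toReal / p - 1)) ^
    (1 / q.toReal)

/-- Membership in the Lorentz space `l_{p,q}`. -/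
def MemLorentz (p : ℝ) (q : ℝ≥0∞) (a : ℕ → ℂ) : Prop :=
  Filter.Tendsto a Filter.atTop (𝓝 0) ∧ lorentzNorm p q a < ∞

/-- `a` enumerates the nonzero eigenvalues of `T`, each of them repeated according to its
algebraic multiplicity, which has to be finite; zero terms may be interspersed. -/
def IsEigenvalueSequence {X : Type*} [NormedAddCommGroup X] [NormedSpace ℂ X]
    (T : X →L[ℂ] X) (a : ℕ → ℂ) : Prop :=
  ∀ μ : ℂ, μ ≠ 0 →
    FiniteDimensional ℂ (Module.End.maxGenEigenspace (T : Module.End ℂ X) μ) ∧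
    {n | a n = μ}.Finite ∧
    {n | a n = μ}.ncard =
      Module.finrank ℂ (Module.End.maxGenEigenspace (T : Module.End ℂ X) μ)

/-- `T` has spectral type `l_{p,q}`: its nonzero eigenvalues have finite algebraic multiplicity and
accumulate at most at zero, and the sequence of them, counted with multiplicity, lies in `l_{p,q}`.
(The sequence tends to zero, which excludes other accumulation points; `l_{p,q}` and its
quasinorm depend neither on the order of the terms nor on zero terms.) -/
def HasSpectralType {X : Type*} [NormedAddCommGroup X] [NormedSpace ℂ X]
    (p : ℝ) (q : ℝ≥0∞) (T : X →L[ℂ] X) : Prop :=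
  ∃ a : ℕ → ℂ, IsEigenvalueSequence T a ∧ MemLorentz p q a

/-- A space of operators has spectral type `l_{p,q}` if all its members do. -/
def SpaceHasSpectralType {X : Type*} [NormedAddCommGroup X] [NormedSpace ℂ X]
    (p : ℝ) (q : ℝ≥0∞) (L : Submodule ℂ (X →L[ℂ] X)) : Prop :=
  ∀ T ∈ L, HasSpectralType p q T

end

/-! An operator in N_α(X₀) and a suitable operator in N_α(X) turn out to be the two products of one
pair of maps. Given z₀, the extension property supplies z ∈ X* ⊗̂_α X₀ with z ∘ i = z₀. Let R : X →
X₀ be the operator of z. Then R ∘ i is the operator of z₀, while i ∘ R is the operator of i ∘ z,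
which is α-nuclear on X by the metric mapping property (`map_mem_tensor`).

The two products share their nonzero eigenvalues with algebraic multiplicities
(`map_maxGenEigenspace_comp`): i intertwines them, and since generalized eigenvectors of i ∘ R for μ
≠ 0 lie in its range, they already come from X₀. Hence one and the same sequence enumerates both
spectra, and its membership in l_{p,q} carries over from X to X₀. -/

namespace ProjTensor

/-! ### Tensors, their operators and composition -/

variable {X Y Z X' Y' : Type*} [NormedAddCommGroup X] [NormedSpace ℂ X]
  [NormedAddCommGroup Y] [NormedSpace ℂ Y] [NormedAddCommGroup Z] [NormedSpace ℂ Z]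
  [NormedAddCommGroup X'] [NormedSpace ℂ X'] [NormedAddCommGroup Y'] [NormedSpace ℂ Y']

/-- Bounded linear maps on `X ⊗̂ Y` are determined by their values on elementary tensors. -/
theorem clm_ext {f g : ProjTensor X Y →L[ℂ] Z} (h : ∀ x y, f (tmul x y) = g (tmul x y)) :
    f = g := by
  ext u
  induction u using UniformSpace.Completion.induction_on with
  | hp => exact isClosed_eq f.continuous g.continuous
  | ih w =>
    change f (ofAlg w) = g (ofAlg w)
    -- A cost of `w` comes with a finite sum of elementary tensors; only that representation matters
    -- here.
    obtain ⟨_, n, x, y, rfl, -⟩ := AlgTensor.costs_nonempty w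
    simp only [map_sum]
    exact Finset.sum_congr rfl fun k _ => h (x k) (y k)

/-- `A ⊗ B` maps the algebraic tensor product into the algebraic tensor product. -/
theorem exists_map_ofAlg (A : X →L[ℂ] X') (B : Y →L[ℂ] Y') (w : AlgTensor X Y) :
    ∃ w' : AlgTensor X' Y', map A B (ofAlg w) = ofAlg w' := by
  obtain ⟨_, n, x, y, rfl, -⟩ := AlgTensor.costs_nonempty w
  refine ⟨∑ k, AlgTensor.tmul (A (x k)) (B (y k)), ?_⟩
  simp only [map_sum]
  exact Finset.sum_congr rfl fun k _ => map_tmul A B (x k) (y k)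

/-- Both sides are bounded and linear in `z`, so elementary tensors decide. With B = i this
identifies the operator of i ∘ z. -/
theorem toOperator_compLeft [CompleteSpace Y] [CompleteSpace Y'] (B : Y →L[ℂ] Y')
    (z : ProjTensor (StrongDual ℂ X) Y) :
    toOperator X Y' (compLeft B z) = B ∘L toOperator X Y z := by
  have h : toOperator X Y' ∘L map (ContinuousLinearMap.id ℂ (StrongDual ℂ X)) B =
      ContinuousLinearMap.compL ℂ X Y Y' B ∘L toOperator X Y := by
    refine clm_ext fun f y => ?_
    ext x
    simp [map_tmul, toOperator_tmul]
  exact DFunLike.congr_fun h z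

theorem toOperator_compRight [CompleteSpace Y] (A : X' →L[ℂ] X)
    (z : ProjTensor (StrongDual ℂ X) Y) :
    toOperator X' Y (compRight z A) = toOperator X Y z ∘L A := by
  have h : toOperator X' Y ∘L
        map ((ContinuousLinearMap.compL ℂ X' X ℂ).flip A) (ContinuousLinearMap.id ℂ Y) =
      (ContinuousLinearMap.compL ℂ X' X Y).flip A ∘L toOperator X Y := by
    refine clm_ext fun f y => ?_
    ext x
    simp [map_tmul, toOperator_tmul]
  exact DFunLike.congr_fun h z

end ProjTensor

/-- The metric mapping property: `A ⊗ B` maps `X ⊗̂_α Y` into `E ⊗̂_α F`. -/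
theorem ProjectiveTensorQuasinorm.map_mem_tensor (α : ProjectiveTensorQuasinorm.{u})
    {X Y E F : Type u} [NormedAddCommGroup X] [NormedSpace ℂ X] [CompleteSpace X]
    [NormedAddCommGroup Y] [NormedSpace ℂ Y] [CompleteSpace Y]
    [NormedAddCommGroup E] [NormedSpace ℂ E] [CompleteSpace E]
    [NormedAddCommGroup F] [NormedSpace ℂ F] [CompleteSpace F]
    (A : X →L[ℂ] E) (B : Y →L[ℂ] F) {z : ProjTensor X Y} (hz : z ∈ α.tensor X Y) :
    ProjTensor.map A B z ∈ α.tensor E F := by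
  obtain ⟨hfin, w, hw⟩ := hz
  -- The images of the algebraic approximants of `z` approximate the image of `z`, with error at
  -- most ‖A‖ ‖B‖ times the original one.
  choose w' hw' using fun n => ProjTensor.exists_map_ofAlg A B (w n)
  refine ⟨(α.val_map_le A B z).trans_lt
    (ENNReal.mul_lt_top (ENNReal.mul_lt_top enorm_lt_top hfin) enorm_lt_top), w', ?_⟩
  have hlim := ENNReal.Tendsto.mul_const (b := ‖B‖ₑ)
    (ENNReal.Tendsto.const_mul (a := ‖A‖ₑ) hw (Or.inr enorm_ne_top)) (Or.inr enorm_ne_top)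
  simp only [mul_zero, zero_mul] at hlim
  refine tendsto_of_tendsto_of_tendsto_of_le_of_le tendsto_const_nhds hlim
    (fun _ => zero_le) fun n => ?_
  simp only [← hw', ← map_sub]
  exact α.val_map_le A B _

/-! ### Generalized eigenspaces of R ∘ i and i ∘ R -/

section RestrictToRange

variable {K V W : Type*} [Field K] [AddCommGroup V] [Module K V] [AddCommGroup W] [Module K W]

/-- Generalized eigenvectors for a nonzero eigenvalue lie in the range of the operator. -/
theorem Module.End.maxGenEigenspace_le_range (T : Module.End K V) {μ : K} (hμ : μ ≠ 0) :
    T.maxGenEigenspace μ ≤ LinearMap.range T := by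
  intro x hx
  obtain ⟨k, hk⟩ := (Module.End.mem_maxGenEigenspace T μ x).1 hx
  clear hx
  induction k generalizing x with
  | zero => rw [show x = 0 by simpa using hk]; exact zero_mem _
  | succ k ih =>
    rw [pow_succ, Module.End.mul_apply] at hk
    -- The vector (T - μ)x is killed by the k-th power, so it lies in the range by induction; then
    -- so does μx = Tx - (T - μ)x.
    have h := ih hk
    have hx : μ • x = T x - (T - μ • 1) x := by simp
    have : μ • x ∈ LinearMap.range T := hx ▸ sub_mem (LinearMap.mem_range_self T x) h
    exact (Submodule.smul_mem_iff _ hμ).1 this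

/-- If `S = R ∘ i` and `T = i ∘ R` with `i` injective, then `i` identifies the generalized
eigenspaces of `S` and `T` for nonzero eigenvalues. -/
theorem Module.End.map_maxGenEigenspace_comp (i : W →ₗ[K] V) (hi : Function.Injective i)
    (R : V →ₗ[K] W) {μ : K} (hμ : μ ≠ 0) :
    (Module.End.maxGenEigenspace (R ∘ₗ i : Module.End K W) μ).map i =
      Module.End.maxGenEigenspace (i ∘ₗ R : Module.End K V) μ := by
  -- The identity (i ∘ R) ∘ i = i ∘ (R ∘ i) passes to shifts by μ and to their powers.
  have hpow : ∀ (k : ℕ) (w : W), (((i ∘ₗ R : Module.End K V) - μ • 1) ^ k) (i w) =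
      i ((((R ∘ₗ i : Module.End K W) - μ • 1) ^ k) w) := by
    intro k
    induction k with
    | zero => simp
    | succ k ih =>
      intro w
      rw [pow_succ, pow_succ, Module.End.mul_apply, Module.End.mul_apply, ← ih]
      simp
  have hmem : ∀ w : W, i w ∈ Module.End.maxGenEigenspace (i ∘ₗ R : Module.End K V) μ ↔
      w ∈ Module.End.maxGenEigenspace (R ∘ₗ i : Module.End K W) μ := by
    intro w
    simp only [Module.End.mem_maxGenEigenspace, hpow, map_eq_zero_iff i hi]
  ext x
  constructor
  · rintro ⟨w, hw, rfl⟩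
    exact (hmem w).2 hw
  · intro hx
    -- Here μ ≠ 0 enters: x = i(Rv), which gives the preimage Rv under i.
    obtain ⟨v, rfl⟩ := Module.End.maxGenEigenspace_le_range _ hμ hx
    exact ⟨R v, (hmem _).1 hx, rfl⟩

end RestrictToRange

/-- Related operators `R ∘ i` and `i ∘ R`, with `i` injective, have the same eigenvalue
sequences. -/
theorem isEigenvalueSequence_comp {X Y : Type*} [NormedAddCommGroup X] [NormedSpace ℂ X]
    [NormedAddCommGroup Y] [NormedSpace ℂ Y] (i : Y →L[ℂ] X) (hi : Function.Injective i)
    (R : X →L[ℂ] Y) {a : ℕ → ℂ} (ha : IsEigenvalueSequence (i ∘L R) a) :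
    IsEigenvalueSequence (R ∘L i) a := by
  intro μ hμ
  obtain ⟨hfd, hfin, hcard⟩ := ha μ hμ
  have hmap := Module.End.map_maxGenEigenspace_comp (i : Y →ₗ[ℂ] X) hi (R : X →ₗ[ℂ] Y) hμ
  have e := (Submodule.equivMapOfInjective (i : Y →ₗ[ℂ] X) hi _).trans
    (LinearEquiv.ofEq _ _ hmap)
  exact ⟨@Module.Finite.equiv _ _ _ _ _ _ _ _ hfd e.symm, hfin, hcard.trans e.finrank_eq.symm⟩

/-! ### Passage from X to the subspace -/

theorem mainTheorem7 (α : ProjectiveTensorQuasinorm.{u}) (hα : α.IsComplete)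
    (X : Type u) [NormedAddCommGroup X] [NormedSpace ℂ X] [CompleteSpace X]
    (hX : α.HasExtensionProperty X)
    (p : ℝ) (hp : 0 < p) (q : ℝ≥0∞) (hq : 0 < q)
    (hN : SpaceHasSpectralType p q (α.nuclear X X))
    (X₀ : Submodule ℂ X) [CompleteSpace X₀] :
    SpaceHasSpectralType p q (α.nuclear X₀ X₀) := by
  rintro _ ⟨z₀, hz₀, rfl⟩
  -- From here on z₀ is literally z ∘ i.
  obtain ⟨z, hz, rfl, -⟩ := hX X₀ z₀ hz₀
  obtain ⟨a, ha, ha'⟩ := hN (ProjTensor.toOperator X X (ProjTensor.compLeft X₀.subtypeL z))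
    ⟨_, α.map_mem_tensor _ _ hz, rfl⟩
  rw [ProjTensor.toOperator_compLeft] at ha
  refine ⟨a, ?_, ha'⟩
  have h := isEigenvalueSequence_comp X₀.subtypeL Subtype.val_injective _ ha
  rwa [← ProjTensor.toOperator_compRight] at h
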